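/- For a real $n\times n$ matrix $H=(h_{ij})$ write $\|H\|_1=\sum_{i,j}|h_{ij}|$, and let $J$ be the all-ones matrix and $\langle X,Y\rangle=\sum_{i,j}x_{ij}y_{ij}$. For a symmetric matrix $A\in\mathbb{R}^{n\times n}$ consider the linear program $$(\mathrm{P})\qquad \min\ \langle J,H^+\rangle+\langle J,H^-\rangle\quad\text{s.t.}\quad A(H^+-H^-)A=A,\quad H^+,H^-\ge 0 \text{ (entrywise)},$$ which is the LP for $\min\{\|H\|_1 : AHA=A\}$ with $H:=H^+-H^-$, and the linear program $(\mathrm{P}_{\mathrm{sym}})$, the LP for $\min\{\|H\|_1 : AHA=A,\ H^\top=H\}$, obtained from $(\mathrm{P})$ by adding the constraint $(H^+-H^-)^\top=H^+-H^-$. Suppose that $A\in\mathbb{R}^{n\times n}$ is symmetric of rank $r$. (1) For every extreme point $(H^+,H^-)$ of the feasible region of $(\mathrm{P})$ (in particular, for every extreme optimal solution), the matrix $H=H^+-H^-$ has at most $r^2$ nonzero entries. This bound is sharp for all $n\ge r\ge 1$: for all such $n,r$ there is a symmetric $A\in\mathbb{R}^{n\times n}$ of rank $r$ for which $(\mathrm{P})$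 has a unique optimal solution, this solution is an extreme point of the feasible region, and its $H$ has exactly $r^2$ nonzero entries. (2) For every extreme point $(H^+,H^-)$ of the feasible region of $(\mathrm{P}_{\mathrm{sym}})$ (in particular, for every extreme optimal solution), the matrix $H=H^+-H^-$ has at most $r^2+r$ nonzero entries. This bound is sharp whenever $n-2\ge r\ge 3$: for all such $n,r$ there is a symmetric $A\in\mathbb{R}^{n\times n}$ of rank $r$ for which $(\mathrm{P}_{\mathrm{sym}})$ has a unique optimal solution, this solution is an extreme point of the feasible region, and its $H$ has exactly $r^2+r$ nonzero entries. -/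

import Mathlib

/-- The feasible region, in the variables `(H⁺, H⁻)`, of the linear program
`min ⟨J, H⁺⟩ + ⟨J, H⁻⟩` subject to `A (H⁺ - H⁻) A = A`, `H⁺ ≥ 0`, `H⁻ ≥ 0`,
which is the LP for `min {‖H‖₁ : A H A = A}` with `H = H⁺ - H⁻`. -/
def ginvRegion {n : ℕ} (A : Matrix (Fin n) (Fin n) ℝ) :
    Set (Matrix (Fin n) (Fin n) ℝ × Matrix (Fin n) (Fin n) ℝ) :=
  {p | A * (p.1 - p.2) * A = A ∧ (∀ i j, 0 ≤ p.1 i j) ∧ (∀ i j, 0 ≤ p.2 i j)}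

/-- The feasible region of the LP for `min {‖H‖₁ : A H A = A, Hᵀ = H}`, `H = H⁺ - H⁻`. -/
def symGinvRegion {n : ℕ} (A : Matrix (Fin n) (Fin n) ℝ) :
    Set (Matrix (Fin n) (Fin n) ℝ × Matrix (Fin n) (Fin n) ℝ) :=
  {p | p ∈ ginvRegion A ∧ (p.1 - p.2).transpose = p.1 - p.2}

/-- The LP objective `⟨J, H⁺⟩ + ⟨J, H⁻⟩`, with `J` the all-ones matrix. -/
def lpCost {n : ℕ} (p : Matrix (Fin n) (Fin n) ℝ × Matrix (Fin n) (Fin n) ℝ) : ℝ :=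
  (∑ i, ∑ j, p.1 i j) + ∑ i, ∑ j, p.2 i j

/-- `p` is an optimal solution of the LP `min {lpCost q : q ∈ F}`. -/
def IsLPOptimal {n : ℕ} (F : Set (Matrix (Fin n) (Fin n) ℝ × Matrix (Fin n) (Fin n) ℝ))
    (p : Matrix (Fin n) (Fin n) ℝ × Matrix (Fin n) (Fin n) ℝ) : Prop :=
  p ∈ F ∧ ∀ q ∈ F, lpCost p ≤ lpCost q

/-- The number `‖H‖₀` of nonzero entries of `H`. -/
noncomputable def nnzEntries {n : ℕ} (H : Matrix (Fin n) (Fin n) ℝ) : ℕ :=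
  {ij : Fin n × Fin n | H ij.1 ij.2 ≠ 0}.ncard

/-!
A direction supported on the support of `H = H⁺ - H⁻` and annihilated by `D ↦ A * D * A` can be
added to and subtracted from an extreme point, so it vanishes. Writing `A = B * C` through
dimension `r`, the map factors through `D ↦ C * D * B`, whose target has dimension `r²`, and this
bounds the support. For symmetric `A` and `D` one may take `C = Bᵀ`, up to an outer factor, and the
target consists of the symmetric matrices, of dimension `r (r + 1) / 2`; this bounds the number of
unordered pairs of indices in the support, each of which gives at most two entries of `H`.

Sharpness of the first bound is clear for `A = H⁻¹` with `H` an invertible `r × r` matrix without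
zero entries, padded by zeros. For the second, choose a symmetric `H`, a matrix `X`, and a
symmetric `W` with `W * X = 0` which agrees with the sign of `H` on its support and has entries in
`(-1, 1)` off it. The upper left block `A` of the inverse of the bordered matrix
`[[H, X], [Xᵀ, 0]]` satisfies `A * H * A = A` and `A * X = 0`, so the symmetric solutions of
`A * D * A = 0` are the matrices `X * Zᵀ + Z * Xᵀ`. They are orthogonal to `W`, hence `W` certifies
that `H` is optimal, and uniquely so when no nonzero one is supported on the support of `H`. For
`r ≥ 4` a Seidel matrix `H` of order `r + 1` works, with a single column `X`; for `r = 3` there is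
an example of order `5`, with two columns.
-/

open Matrix Topology

section ExtremePoints

/-- The real symmetric matrices, as a linear space. -/
def symmetricMatrices (ι : Type*) : Submodule ℝ (Matrix ι ι ℝ) where
  carrier := {M | M.IsSymm}
  add_mem' := IsSymm.add
  zero_mem' := isSymm_zero
  smul_mem' c _ hM := hM.smul c

theorem mem_symmetricMatrices {ι : Type*} {M : Matrix ι ι ℝ} :
    M ∈ symmetricMatrices ι ↔ M.IsSymm :=
  Iff.rfl

variable {n : ℕ} {A : Matrix (Fin n) (Fin n) ℝ}
  {𝒱 : Submodule ℝ (Matrix (Fin n) (Fin n) ℝ)}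
  {p : Matrix (Fin n) (Fin n) ℝ × Matrix (Fin n) (Fin n) ℝ}

/-- The points `(H⁺, H⁻)` of `ginvRegion A` with `H⁺ - H⁻` in the linear space `𝒱`. The two
linear programs are the cases `𝒱 = ⊤` and `𝒱 = symmetricMatrices (Fin n)`. -/
def ginvRegionIn (𝒱 : Submodule ℝ (Matrix (Fin n) (Fin n) ℝ)) (A : Matrix (Fin n) (Fin n) ℝ) :
    Set (Matrix (Fin n) (Fin n) ℝ × Matrix (Fin n) (Fin n) ℝ) :=
  {p | p ∈ ginvRegion A ∧ p.1 - p.2 ∈ 𝒱}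

theorem ginvRegionIn_top (A : Matrix (Fin n) (Fin n) ℝ) : ginvRegionIn ⊤ A = ginvRegion A :=
  Set.ext fun _ => and_iff_left Submodule.mem_top

theorem ginvRegionIn_symmetricMatrices (A : Matrix (Fin n) (Fin n) ℝ) :
    ginvRegionIn (symmetricMatrices (Fin n)) A = symGinvRegion A :=
  rfl

theorem eventually_nonneg_add_mul {a b : ℝ} (ha : 0 ≤ a) (hb : a = 0 → b = 0) :
    ∀ᶠ t in 𝓝 (0 : ℝ), 0 ≤ a + t * b := by
  rcases ha.eq_or_lt with rfl | ha
  · simp [hb rfl]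
  · have hcont : Filter.Tendsto (fun t : ℝ => a + t * b) (𝓝 0) (𝓝 (a + 0 * b)) := by
      apply Continuous.tendsto
      fun_prop
    rw [zero_mul, add_zero] at hcont
    exact (hcont.eventually_const_lt ha).mono fun _ => le_of_lt

theorem eventually_add_smul_mem_ginvRegionIn (hp : p ∈ ginvRegionIn 𝒱 A)
    {E : Matrix (Fin n) (Fin n) ℝ × Matrix (Fin n) (Fin n) ℝ} (hE : E.1 - E.2 ∈ 𝒱)
    (hAE : A * (E.1 - E.2) * A = 0) (hE₁ : ∀ i j, p.1 i j = 0 → E.1 i j = 0)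
    (hE₂ : ∀ i j, p.2 i j = 0 → E.2 i j = 0) :
    ∀ᶠ t in 𝓝 (0 : ℝ), p + t • E ∈ ginvRegionIn 𝒱 A := by
  obtain ⟨⟨hAp, hp₁, hp₂⟩, hp𝒱⟩ := hp
  have h₁ : ∀ᶠ t in 𝓝 (0 : ℝ), ∀ i j, 0 ≤ p.1 i j + t * E.1 i j :=
    Filter.eventually_all.2 fun i => Filter.eventually_all.2 fun j =>
      eventually_nonneg_add_mul (hp₁ i j) (hE₁ i j)
  have h₂ : ∀ᶠ t in 𝓝 (0 : ℝ), ∀ i j, 0 ≤ p.2 i j + t * E.2 i j :=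
    Filter.eventually_all.2 fun i => Filter.eventually_all.2 fun j =>
      eventually_nonneg_add_mul (hp₂ i j) (hE₂ i j)
  filter_upwards [h₁, h₂] with t ht₁ ht₂
  have hsub : (p + t • E).1 - (p + t • E).2 = (p.1 - p.2) + t • (E.1 - E.2) := by
    rw [Prod.fst_add, Prod.snd_add, Prod.smul_fst, Prod.smul_snd, smul_sub]
    abel
  refine ⟨⟨?_, ht₁, ht₂⟩, ?_⟩
  · rw [hsub, mul_add, add_mul, hAp, Matrix.mul_smul, Matrix.smul_mul, hAE, smul_zero, add_zero]
  · rw [hsub]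
    exact 𝒱.add_mem hp𝒱 (𝒱.smul_mem t hE)

theorem eq_zero_of_eventually_add_smul_mem {E : Type*} [AddCommGroup E] [Module ℝ E] {F : Set E}
    {x d : E} (hx : x ∈ F.extremePoints ℝ) (hd : ∀ᶠ t in 𝓝 (0 : ℝ), x + t • d ∈ F) : d = 0 := by
  have hneg : ∀ᶠ t in 𝓝 (0 : ℝ), x + (-t) • d ∈ F :=
    (continuous_neg.tendsto' (0 : ℝ) 0 neg_zero).eventually hd
  obtain ⟨t, ⟨hpos, hneg⟩, ht⟩ :=
    (((hd.and hneg).filter_mono nhdsWithin_le_nhds).and (self_mem_nhdsWithin (s := {0}ᶜ))).exists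
  have hseg : x ∈ openSegment ℝ (x + t • d) (x + (-t) • d) :=
    ⟨1 / 2, 1 / 2, by norm_num, by norm_num, by norm_num, by module⟩
  have htd : t • d = 0 := left_eq_add.1 (hx.2 hpos hneg hseg).symm
  exact (smul_eq_zero.1 htd).resolve_left ht

theorem eq_zero_of_mem_extremePoints (hp : p ∈ (ginvRegionIn 𝒱 A).extremePoints ℝ)
    {D : Matrix (Fin n) (Fin n) ℝ} (hD : D ∈ 𝒱) (hAD : A * D * A = 0)
    (hsupp : ∀ i j, (p.1 - p.2) i j = 0 → D i j = 0) : D = 0 := by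
  let E : Matrix (Fin n) (Fin n) ℝ × Matrix (Fin n) (Fin n) ℝ :=
    (of fun i j => if p.1 i j = 0 then 0 else D i j,
      of fun i j => if p.1 i j = 0 then -D i j else 0)
  have hsub : E.1 - E.2 = D := by
    ext i j
    by_cases h : p.1 i j = 0 <;> simp [E, h]
  have hE₁ : ∀ i j, p.1 i j = 0 → E.1 i j = 0 := fun i j h => if_pos h
  have hE₂ : ∀ i j, p.2 i j = 0 → E.2 i j = 0 := by
    intro i j h₂
    by_cases h₁ : p.1 i j = 0
    · simp [E, hsupp i j (by simp [h₁, h₂])]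
    · simp [E, h₁]
  have hE : E = 0 := eq_zero_of_eventually_add_smul_mem hp <|
    eventually_add_smul_mem_ginvRegionIn hp.1 (hsub ▸ hD) (hsub ▸ hAD) hE₁ hE₂
  rw [← hsub, hE, Prod.fst_zero, Prod.snd_zero, sub_zero]

end ExtremePoints

section SupportBounds

theorem exists_eq_mul_of_rank_eq {K m n : Type*} [Field K] [Fintype n] {A : Matrix m n K} {r : ℕ}
    (hr : A.rank = r) : ∃ (B : Matrix m (Fin r) K) (C : Matrix (Fin r) n K), A = B * C := by
  classical
  let b := Module.finBasisOfFinrankEq K (LinearMap.range A.mulVecLin) hr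
  have hmem (j : n) : A.col j ∈ LinearMap.range A.mulVecLin :=
    ⟨Pi.single j 1, by rw [mulVecLin_apply, mulVec_single_one]⟩
  refine ⟨of fun i k => (b k : m → K) i, of fun k j => b.repr ⟨A.col j, hmem j⟩ k, ?_⟩
  ext i j
  have hsum := congrArg (fun v : LinearMap.range A.mulVecLin => (v : m → K) i)
    (b.sum_repr ⟨A.col j, hmem j⟩)
  simp only [Submodule.coe_sum, Finset.sum_apply, Submodule.coe_smul, Pi.smul_apply,
    smul_eq_mul, col_apply] at hsum
  simp only [mul_apply, of_apply, ← hsum, mul_comm]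

theorem exists_ne_zero_map_eq_zero_of_finrank_lt_ncard {K σ V : Type*} [Field K] [Finite σ]
    [AddCommGroup V] [Module K V] [FiniteDimensional K V] (f : (σ → K) →ₗ[K] V) {S : Set σ}
    (hS : Module.finrank K V < S.ncard) :
    ∃ g : σ → K, g ≠ 0 ∧ (∀ s ∉ S, g s = 0) ∧ f g = 0 := by
  have := Fintype.ofFinite S
  let extend : (S → K) →ₗ[K] σ → K := Function.ExtendByZero.linearMap K Subtype.val
  have hlt : Module.finrank K V < Module.finrank K (S → K) := by
    rwa [Module.finrank_fintype_fun_eq_card, ← Nat.card_eq_fintype_card]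
  obtain ⟨h, hker, hne⟩ := (Submodule.ne_bot_iff _).1 <|
    LinearMap.ker_ne_bot_of_finrank_lt (f := f ∘ₗ extend) hlt
  refine ⟨extend h, fun h0 => hne (funext fun s => ?_), fun s hs => ?_, hker⟩
  · exact (Subtype.val_injective.extend_apply h (0 : σ → K) s).symm.trans (congrFun h0 s)
  · exact Function.extend_apply' h (0 : σ → K) s fun ⟨s', hs'⟩ => hs (hs' ▸ s'.2)

theorem ncard_preimage_sym2_mk_le {α : Type*} [Finite α] (T : Set (Sym2 α)) :
    {ij : α × α | s(ij.1, ij.2) ∈ T}.ncard ≤ 2 * T.ncard := by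
  classical
  have := Fintype.ofFinite α
  rw [Set.ncard_eq_toFinset_card', Set.ncard_eq_toFinset_card']
  refine Finset.card_le_mul_card_image_of_maps_to (f := fun ij : α × α => s(ij.1, ij.2))
    (fun ij hij => by simpa using hij) 2 fun z _ => ?_
  induction z with
  | _ a b =>
    refine (Finset.card_le_card fun ij hij => ?_).trans (Finset.card_le_two (a := (a, b))
      (b := (b, a)))
    simpa [Prod.ext_iff] using (Finset.mem_filter.1 hij).2

/-- A symmetric matrix is a function on unordered pairs of indices; this computes the dimension
`(#ι + 1).choose 2` of the space of symmetric matrices. -/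
def symmetricMatricesEquiv (ι : Type*) : (Sym2 ι → ℝ) ≃ₗ[ℝ] symmetricMatrices ι where
  toFun g := ⟨of fun i j => g s(i, j), IsSymm.ext fun _ _ => congrArg g Sym2.eq_swap⟩
  map_add' _ _ := rfl
  map_smul' _ _ := rfl
  invFun M := Sym2.lift ⟨fun i j => M.1 i j, fun i j => IsSymm.apply M.2 j i⟩
  left_inv _ := funext <| Sym2.ind fun _ _ => rfl
  right_inv _ := rfl

theorem finrank_symmetricMatrices (ι : Type*) [Fintype ι] :
    Module.finrank ℝ (symmetricMatrices ι) = (Fintype.card ι + 1).choose 2 := by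
  classical
  rw [← (symmetricMatricesEquiv ι).finrank_eq, Module.finrank_fintype_fun_eq_card, Sym2.card]

variable {n r : ℕ} {A : Matrix (Fin n) (Fin n) ℝ}
  {p : Matrix (Fin n) (Fin n) ℝ × Matrix (Fin n) (Fin n) ℝ}

theorem nnzEntries_le_of_mem_extremePoints_ginvRegion (hr : A.rank = r)
    (hp : p ∈ (ginvRegion A).extremePoints ℝ) : nnzEntries (p.1 - p.2) ≤ r ^ 2 := by
  obtain ⟨B, C, hBC⟩ := exists_eq_mul_of_rank_eq hr
  rw [← ginvRegionIn_top] at hp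
  by_contra! hlt
  let compress : (Fin n × Fin n → ℝ) →ₗ[ℝ] Matrix (Fin r) (Fin r) ℝ :=
    mulRightLinearMap _ ℝ B ∘ₗ mulLeftLinearMap _ ℝ C ∘ₗ (ofLinearEquiv ℝ).toLinearMap ∘ₗ
      (LinearEquiv.curry ℝ ℝ _ _).toLinearMap
  obtain ⟨g, hg, hsupp, hcompress⟩ :=
    exists_ne_zero_map_eq_zero_of_finrank_lt_ncard compress
      (S := {ij | (p.1 - p.2) ij.1 ij.2 ≠ 0}) (by
        rwa [Module.finrank_matrix, Module.finrank_self, mul_one, Fintype.card_fin, ← sq])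
  let D : Matrix (Fin n) (Fin n) ℝ := of fun i j => g (i, j)
  have hCDB : C * D * B = 0 := hcompress
  have hADA : A * D * A = 0 := by
    calc A * D * A = B * (C * D * B) * C := by
          simp only [hBC, Matrix.mul_assoc]
      _ = 0 := by rw [hCDB, Matrix.mul_zero, Matrix.zero_mul]
  have hD : D = 0 := eq_zero_of_mem_extremePoints hp Submodule.mem_top hADA
    fun i j hij => hsupp (i, j) (not_not_intro hij)
  exact hg (funext fun ij => congrFun₂ hD ij.1 ij.2)

theorem nnzEntries_le_of_mem_extremePoints_symGinvRegion (hA : A.IsSymm)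
    (hr : A.rank = r) (hp : p ∈ (symGinvRegion A).extremePoints ℝ) :
    nnzEntries (p.1 - p.2) ≤ r ^ 2 + r := by
  obtain ⟨B, C, hBC⟩ := exists_eq_mul_of_rank_eq hr
  have hCB : A = Cᵀ * Bᵀ := by rw [← transpose_mul, ← hBC, hA.eq]
  rw [← ginvRegionIn_symmetricMatrices] at hp
  let h : Sym2 (Fin n) → ℝ := (symmetricMatricesEquiv _).symm ⟨p.1 - p.2, hp.1.2⟩
  suffices {z | h z ≠ 0}.ncard ≤ (r + 1).choose 2 by
    calc nnzEntries (p.1 - p.2) ≤ 2 * {z | h z ≠ 0}.ncard :=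
          ncard_preimage_sym2_mk_le {z | h z ≠ 0}
      _ ≤ 2 * (r + 1).choose 2 := Nat.mul_le_mul_left 2 this
      _ = r ^ 2 + r := by
        rw [mul_comm, ← Nat.add_one_mul_choose_eq, Nat.choose_one_right]
        ring
  by_contra! hlt
  let compress : (Sym2 (Fin n) → ℝ) →ₗ[ℝ] symmetricMatrices (Fin r) :=
    (mulRightLinearMap _ ℝ B ∘ₗ mulLeftLinearMap _ ℝ Bᵀ).restrict
        (fun M (hM : M.IsSymm) => by
          simp [mem_symmetricMatrices, IsSymm, hM.eq, Matrix.mul_assoc]) ∘ₗ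
      (symmetricMatricesEquiv (Fin n)).toLinearMap
  obtain ⟨g, hg, hsupp, hcompress⟩ :=
    exists_ne_zero_map_eq_zero_of_finrank_lt_ncard compress (S := {z | h z ≠ 0})
      (by rwa [finrank_symmetricMatrices, Fintype.card_fin])
  let D := symmetricMatricesEquiv (Fin n) g
  have hBDB : Bᵀ * D.1 * B = 0 := congrArg Subtype.val hcompress
  have hADA : A * D.1 * A = 0 := by
    calc A * D.1 * A = Cᵀ * Bᵀ * D.1 * (B * C) := by rw [← hCB, ← hBC]
      _ = Cᵀ * (Bᵀ * D.1 * B) * C := by simp only [Matrix.mul_assoc]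
      _ = 0 := by rw [hBDB, Matrix.mul_zero, Matrix.zero_mul]
  have hD : D.1 = 0 := eq_zero_of_mem_extremePoints hp D.2 hADA
    fun i j hij => hsupp s(i, j) (not_not_intro hij)
  exact hg ((LinearEquiv.map_eq_zero_iff _).1 (Subtype.ext hD))

end SupportBounds

section Duality

variable {n : ℕ} {A W H : Matrix (Fin n) (Fin n) ℝ}
  {𝒱 : Submodule ℝ (Matrix (Fin n) (Fin n) ℝ)}
  {F : Set (Matrix (Fin n) (Fin n) ℝ × Matrix (Fin n) (Fin n) ℝ)}
  {p : Matrix (Fin n) (Fin n) ℝ × Matrix (Fin n) (Fin n) ℝ}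

/-- The linear program over `F` has a unique optimal solution, which is an extreme point of `F`
and whose matrix `H⁺ - H⁻` has exactly `k` nonzero entries. -/
def HasUniqueExtremeOptimum (F : Set (Matrix (Fin n) (Fin n) ℝ × Matrix (Fin n) (Fin n) ℝ))
    (k : ℕ) : Prop :=
  ∃ p ∈ F.extremePoints ℝ, IsLPOptimal F p ∧ (∀ q, IsLPOptimal F q → q = p) ∧
    nnzEntries (p.1 - p.2) = k

/-- An optimality certificate for minimising `‖H‖₁` over the `H ∈ 𝒱` with `A * H * A = A`: the
dual matrix `W` is constant on the feasible set and is a subgradient of `‖·‖₁` at `H`. The last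
field makes `H` the only minimiser. -/
structure IsDualCertificate {ι : Type*} [Fintype ι] (𝒱 : Submodule ℝ (Matrix ι ι ℝ))
    (A W H : Matrix ι ι ℝ) : Prop where
  mem : H ∈ 𝒱
  mul_mul_self : A * H * A = A
  trace_eq_zero : ∀ D ∈ 𝒱, A * D * A = 0 → (Wᵀ * D).trace = 0
  abs_le_one : ∀ i j, |W i j| ≤ 1
  mul_eq_abs : ∀ i j, W i j * H i j = |H i j|
  eq_zero : ∀ D ∈ 𝒱, A * D * A = 0 → (∀ i j, |W i j| < 1 → D i j = 0) → D = 0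

theorem lpCost_add_smul (a b : ℝ) (p q : Matrix (Fin n) (Fin n) ℝ × Matrix (Fin n) (Fin n) ℝ) :
    lpCost (a • p + b • q) = a * lpCost p + b * lpCost q := by
  simp only [lpCost, Prod.fst_add, Prod.snd_add, Prod.smul_fst, Prod.smul_snd,
    Matrix.add_apply, Matrix.smul_apply, smul_eq_mul, Finset.sum_add_distrib, ← Finset.mul_sum]
  ring

theorem isLPOptimal_of_forall_lpCost_le (hp : p ∈ F)
    (huniq : ∀ q ∈ F, lpCost q ≤ lpCost p → q = p) : IsLPOptimal F p :=
  ⟨hp, fun q hq => le_of_not_gt fun hlt => hlt.ne (congrArg lpCost (huniq q hq hlt.le))⟩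

theorem mem_extremePoints_of_forall_lpCost_le (hp : p ∈ F)
    (huniq : ∀ q ∈ F, lpCost q ≤ lpCost p → q = p) : p ∈ F.extremePoints ℝ := by
  obtain ⟨-, hmin⟩ := isLPOptimal_of_forall_lpCost_le hp huniq
  refine ⟨hp, fun x hx y hy ⟨a, b, ha, hb, hab, hxy⟩ => huniq x hx ?_⟩
  have hcost : a * lpCost x + b * lpCost y = lpCost p := by rw [← lpCost_add_smul, hxy]
  have hb_le : b * lpCost p ≤ b * lpCost y := mul_le_mul_of_nonneg_left (hmin y hy) hb.le
  refine le_of_mul_le_mul_left ?_ ha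
  linear_combination hcost + hb_le - hab * lpCost p

theorem lpCost_eq_trace_add (W : Matrix (Fin n) (Fin n) ℝ)
    (p : Matrix (Fin n) (Fin n) ℝ × Matrix (Fin n) (Fin n) ℝ) :
    lpCost p = (Wᵀ * (p.1 - p.2)).trace +
      ∑ j, ∑ i, ((1 - W i j) * p.1 i j + (1 + W i j) * p.2 i j) := by
  rw [lpCost, Finset.sum_comm (f := fun i j => p.1 i j),
    Finset.sum_comm (f := fun i j => p.2 i j)]
  simp only [trace, diag_apply, mul_apply, transpose_apply, Matrix.sub_apply,
    ← Finset.sum_add_distrib]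
  exact Finset.sum_congr rfl fun j _ => Finset.sum_congr rfl fun i _ => by ring

theorem complementary_slackness (hW : ∀ i j, |W i j| ≤ 1) (hp₁ : ∀ i j, 0 ≤ p.1 i j)
    (hp₂ : ∀ i j, 0 ≤ p.2 i j) (hcost : lpCost p ≤ (Wᵀ * (p.1 - p.2)).trace) (i j : Fin n) :
    (1 - W i j) * p.1 i j = 0 ∧ (1 + W i j) * p.2 i j = 0 := by
  have h₁ (i j) : 0 ≤ (1 - W i j) * p.1 i j :=
    mul_nonneg (sub_nonneg.2 (le_of_abs_le (hW i j))) (hp₁ i j)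
  have h₂ (i j) : 0 ≤ (1 + W i j) * p.2 i j :=
    mul_nonneg (neg_le_iff_add_nonneg'.1 (neg_le_of_abs_le (hW i j))) (hp₂ i j)
  have hnonneg (j i) : 0 ≤ (1 - W i j) * p.1 i j + (1 + W i j) * p.2 i j :=
    add_nonneg (h₁ i j) (h₂ i j)
  rw [lpCost_eq_trace_add W, add_le_iff_nonpos_right] at hcost
  have hsum := hcost.antisymm <|
    Finset.sum_nonneg fun j _ => Finset.sum_nonneg fun i _ => hnonneg j i
  rw [Fintype.sum_eq_zero_iff_of_nonneg fun j => Finset.sum_nonneg fun i _ => hnonneg j i] at hsum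
  have hentry := congrFun ((Fintype.sum_eq_zero_iff_of_nonneg (hnonneg j)).1 (congrFun hsum j)) i
  exact (add_eq_zero_iff_of_nonneg (h₁ i j) (h₂ i j)).1 hentry

theorem eq_posPart_and_eq_negPart {w h a b : ℝ} (hab : a - b = h) (ha : 0 ≤ a) (hb : 0 ≤ b)
    (hwa : (1 - w) * a = 0) (hwb : (1 + w) * b = 0) : a = h⁺ ∧ b = h⁻ := by
  have h_or : a = 0 ∨ b = 0 := by
    by_contra! hne
    linarith [(mul_eq_zero.1 hwa).resolve_right hne.1,
      (mul_eq_zero.1 hwb).resolve_right hne.2]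
  subst hab
  rcases h_or with rfl | rfl <;> simp [ha, hb]

namespace IsDualCertificate

theorem eq_zero_of_abs_lt_one (h : IsDualCertificate 𝒱 A W H) {i j : Fin n}
    (hij : |W i j| < 1) : H i j = 0 := by
  by_contra hne
  refine (mul_lt_of_lt_one_left (abs_pos.2 hne) hij).ne ?_
  rw [← abs_mul, h.mul_eq_abs, abs_abs]

theorem posPart_negPart_mem (h : IsDualCertificate 𝒱 A W H) :
    (H.map (·⁺), H.map (·⁻)) ∈ ginvRegionIn 𝒱 A := by
  have hsub : H.map (·⁺) - H.map (·⁻) = H := ext fun i j => posPart_sub_negPart (H i j)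
  exact ⟨⟨(congrArg (A * · * A) hsub).trans h.mul_mul_self, fun _ _ => posPart_nonneg _,
    fun _ _ => negPart_nonneg _⟩, hsub.symm ▸ h.mem⟩

theorem trace_mul_sub (h : IsDualCertificate 𝒱 A W H) (hp : p ∈ ginvRegionIn 𝒱 A) :
    (Wᵀ * (p.1 - p.2)).trace = (Wᵀ * H).trace := by
  rw [← sub_eq_zero, ← trace_sub, ← Matrix.mul_sub]
  refine h.trace_eq_zero _ (𝒱.sub_mem hp.2 h.mem) ?_
  rw [Matrix.mul_sub, Matrix.sub_mul, hp.1.1, h.mul_mul_self, sub_self]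

theorem lpCost_posPart_negPart (h : IsDualCertificate 𝒱 A W H) :
    lpCost (H.map (·⁺), H.map (·⁻)) = (Wᵀ * H).trace := by
  rw [lpCost_eq_trace_add W, h.trace_mul_sub h.posPart_negPart_mem, add_eq_left]
  refine Finset.sum_eq_zero fun j _ => Finset.sum_eq_zero fun i _ => ?_
  simp only [Matrix.map_apply]
  linear_combination posPart_add_negPart (H i j) - h.mul_eq_abs i j -
    W i j * posPart_sub_negPart (H i j)

theorem eq_posPart_negPart_of_lpCost_le (h : IsDualCertificate 𝒱 A W H)
    {q : Matrix (Fin n) (Fin n) ℝ × Matrix (Fin n) (Fin n) ℝ} (hq : q ∈ ginvRegionIn 𝒱 A)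
    (hcost : lpCost q ≤ lpCost (H.map (·⁺), H.map (·⁻))) : q = (H.map (·⁺), H.map (·⁻)) := by
  rw [h.lpCost_posPart_negPart, ← h.trace_mul_sub hq] at hcost
  have hslack := complementary_slackness h.abs_le_one hq.1.2.1 hq.1.2.2 hcost
  have hzero (i j) (hij : |W i j| < 1) : (q.1 - q.2 - H) i j = 0 := by
    obtain ⟨hW₁, hW₂⟩ := abs_lt.1 hij
    have hq₁ := (mul_eq_zero.1 (hslack i j).1).resolve_left (by linarith)
    have hq₂ := (mul_eq_zero.1 (hslack i j).2).resolve_left (by linarith)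
    rw [Matrix.sub_apply, Matrix.sub_apply, hq₁, hq₂, h.eq_zero_of_abs_lt_one hij, sub_zero,
      sub_zero]
  have hsub : q.1 - q.2 = H := by
    refine sub_eq_zero.1 (h.eq_zero _ (𝒱.sub_mem hq.2 h.mem) ?_ hzero)
    rw [Matrix.mul_sub, Matrix.sub_mul, hq.1.1, h.mul_mul_self, sub_self]
  have hparts (i j) : q.1 i j = (H i j)⁺ ∧ q.2 i j = (H i j)⁻ :=
    eq_posPart_and_eq_negPart (congrFun₂ hsub i j) (hq.1.2.1 i j) (hq.1.2.2 i j)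
      (hslack i j).1 (hslack i j).2
  exact Prod.ext (ext fun i j => (hparts i j).1) (ext fun i j => (hparts i j).2)

theorem hasUniqueExtremeOptimum (h : IsDualCertificate 𝒱 A W H) :
    HasUniqueExtremeOptimum (ginvRegionIn 𝒱 A) (nnzEntries H) := by
  have huniq := fun q => h.eq_posPart_negPart_of_lpCost_le (q := q)
  refine ⟨_, mem_extremePoints_of_forall_lpCost_le h.posPart_negPart_mem huniq,
    isLPOptimal_of_forall_lpCost_le h.posPart_negPart_mem huniq,
    fun q hq => huniq q hq.1 (hq.2 _ h.posPart_negPart_mem), ?_⟩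
  exact congrArg nnzEntries (ext fun i j => posPart_sub_negPart (H i j))

end IsDualCertificate

end Duality

section Padding

variable {ι κ : Type*} [DecidableEq κ]

/-- The 0-1 matrix whose row `a` is the standard basis vector `e a`. -/
def selectRows (e : ι ↪ κ) : Matrix ι κ ℝ :=
  (1 : Matrix κ κ ℝ).submatrix e id

theorem selectRows_mul_mul_transpose [Fintype κ] (e : ι ↪ κ) (D : Matrix κ κ ℝ) :
    selectRows e * D * (selectRows e)ᵀ = D.submatrix e e := by
  rw [selectRows, transpose_submatrix, transpose_one, ← Equiv.coe_refl, one_submatrix_mul,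
    mul_submatrix_one, submatrix_submatrix]
  rfl

variable [Fintype ι] (e : ι ↪ κ)

/-- The matrix `M` placed on the rows and columns in the range of `e`, and zero elsewhere. -/
def pad (M : Matrix ι ι ℝ) : Matrix κ κ ℝ :=
  (selectRows e)ᵀ * M * selectRows e

theorem transpose_pad (M : Matrix ι ι ℝ) : (pad e M)ᵀ = pad e Mᵀ := by
  simp only [pad, transpose_mul, transpose_transpose, Matrix.mul_assoc]

theorem pad_apply_apply (M : Matrix ι ι ℝ) (a b : ι) : pad e M (e a) (e b) = M a b := by
  classical
  simp [pad, selectRows, mul_apply, one_apply]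

theorem submatrix_pad (M : Matrix ι ι ℝ) : (pad e M).submatrix e e = M :=
  ext fun a b => pad_apply_apply e M a b

theorem eq_zero_of_pad_eq_zero {M : Matrix ι ι ℝ} (h : pad e M = 0) : M = 0 := by
  rw [← submatrix_pad e M, h]
  rfl

theorem mem_range_or_pad_eq_zero (i j : κ) :
    (∃ a b, e a = i ∧ e b = j) ∨ ∀ M, pad e M i j = 0 := by
  by_cases hi : ∃ a, e a = i
  · by_cases hj : ∃ b, e b = j
    · exact .inl ⟨hi.choose, hj.choose, hi.choose_spec, hj.choose_spec⟩
    · push Not at hj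
      exact .inr fun M => Finset.sum_eq_zero fun b _ => by simp [selectRows, hj]
  · push Not at hi
    refine .inr fun M => ?_
    rw [pad, Matrix.mul_assoc]
    exact Finset.sum_eq_zero fun a _ => by simp [selectRows, hi]

variable [Fintype κ]

theorem trace_pad_mul (M : Matrix ι ι ℝ) (D : Matrix κ κ ℝ) :
    (pad e M * D).trace = (M * D.submatrix e e).trace := by
  rw [pad, ← selectRows_mul_mul_transpose, Matrix.mul_assoc, Matrix.mul_assoc, trace_mul_comm,
    Matrix.mul_assoc]

theorem pad_mul_mul_pad (M : Matrix ι ι ℝ) (D : Matrix κ κ ℝ) :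
    pad e M * D * pad e M = pad e (M * D.submatrix e e * M) := by
  simp only [pad, ← selectRows_mul_mul_transpose, Matrix.mul_assoc]

theorem rank_pad (M : Matrix ι ι ℝ) : (pad e M).rank = M.rank := by
  apply le_antisymm
  · exact (rank_mul_le_left _ _).trans (rank_mul_le_right _ _)
  · nth_rw 1 [← submatrix_pad e M, ← selectRows_mul_mul_transpose]
    exact (rank_mul_le_left _ _).trans (rank_mul_le_right _ _)

theorem nnzEntries_pad {n : ℕ} (e : ι ↪ Fin n) (M : Matrix ι ι ℝ) :
    nnzEntries (pad e M) = {ab : ι × ι | M ab.1 ab.2 ≠ 0}.ncard := by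
  rw [nnzEntries, ← Set.ncard_map (e.prodMap e)]
  congr 1
  ext ⟨i, j⟩
  rcases mem_range_or_pad_eq_zero e i j with ⟨a, b, rfl, rfl⟩ | h
  · simp [pad_apply_apply]
  · simp only [Set.mem_ofPred_eq, h M, ne_eq, not_true_eq_false, false_iff]
    rintro ⟨⟨a, b⟩, hab, hij⟩
    obtain ⟨rfl, rfl⟩ := Prod.mk.inj hij
    exact hab ((pad_apply_apply e M a b).symm.trans (h M))

theorem IsDualCertificate.pad {𝒱 : Submodule ℝ (Matrix ι ι ℝ)} {A W H : Matrix ι ι ℝ}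
    (h : IsDualCertificate 𝒱 A W H) {𝒱' : Submodule ℝ (Matrix κ κ ℝ)} (hH : pad e H ∈ 𝒱')
    (h𝒱 : ∀ D ∈ 𝒱', D.submatrix e e ∈ 𝒱) :
    IsDualCertificate 𝒱' (pad e A) (pad e W) (pad e H) where
  mem := hH
  mul_mul_self := by rw [pad_mul_mul_pad, submatrix_pad, h.mul_mul_self]
  trace_eq_zero D hD hAD := by
    rw [pad_mul_mul_pad] at hAD
    rw [transpose_pad, trace_pad_mul]
    exact h.trace_eq_zero _ (h𝒱 D hD) (eq_zero_of_pad_eq_zero e hAD)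
  abs_le_one i j := by
    rcases mem_range_or_pad_eq_zero e i j with ⟨a, b, rfl, rfl⟩ | hij
    · exact pad_apply_apply e W a b ▸ h.abs_le_one a b
    · simp [hij]
  mul_eq_abs i j := by
    rcases mem_range_or_pad_eq_zero e i j with ⟨a, b, rfl, rfl⟩ | hij
    · simp only [pad_apply_apply, h.mul_eq_abs]
    · simp [hij]
  eq_zero D hD hAD hzero := by
    rw [pad_mul_mul_pad] at hAD
    have hsub : D.submatrix e e = 0 :=
      h.eq_zero _ (h𝒱 D hD) (eq_zero_of_pad_eq_zero e hAD) fun a b hab =>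
        hzero _ _ (by rwa [pad_apply_apply])
    ext i j
    rcases mem_range_or_pad_eq_zero e i j with ⟨a, b, rfl, rfl⟩ | hij
    · exact congrFun₂ hsub a b
    · exact hzero i j (by simp [hij])

end Padding

section Nonsymmetric

theorem posDef_one_add_vecMulVec_one {ι : Type*} [Finite ι] [DecidableEq ι] :
    (1 + vecMulVec 1 1 : Matrix ι ι ℝ).PosDef := by
  have := Fintype.ofFinite ι
  have h := posSemidef_vecMulVec_self_star (1 : ι → ℝ)
  rw [star_one] at h
  exact PosDef.one.add_posSemidef h

variable {ι : Type*} [Fintype ι] [DecidableEq ι]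

theorem isDualCertificate_inv {N W : Matrix ι ι ℝ} (hN : IsUnit N)
    (habs_le : ∀ i j, |W i j| ≤ 1) (hmul : ∀ i j, W i j * N i j = |N i j|) :
    IsDualCertificate ⊤ N⁻¹ W N := by
  have hdet : IsUnit N.det := (isUnit_iff_isUnit_det N).1 hN
  have hinj (D : Matrix ι ι ℝ) (hD : N⁻¹ * D * N⁻¹ = 0) : D = 0 := by
    calc D = N * (N⁻¹ * D * N⁻¹) * N := by
          rw [Matrix.mul_assoc, nonsing_inv_mul_cancel_right _ _ hdet,
            mul_nonsing_inv_cancel_left _ _ hdet]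
      _ = 0 := by rw [hD, Matrix.mul_zero, Matrix.zero_mul]
  exact
    { mem := Submodule.mem_top
      mul_mul_self := by rw [nonsing_inv_mul N hdet, Matrix.one_mul]
      trace_eq_zero := fun D _ hD => by rw [hinj D hD, Matrix.mul_zero, trace_zero]
      abs_le_one := habs_le
      mul_eq_abs := hmul
      eq_zero := fun D _ hD _ => hinj D hD }

theorem exists_isSymm_rank_hasUniqueExtremeOptimum_ginvRegion {n r : ℕ} (hrn : r ≤ n) :
    ∃ A : Matrix (Fin n) (Fin n) ℝ, A.IsSymm ∧ A.rank = r ∧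
      HasUniqueExtremeOptimum (ginvRegion A) (r ^ 2) := by
  let e : Fin r ↪ Fin n := Fin.castLEEmb hrn
  let N : Matrix (Fin r) (Fin r) ℝ := 1 + vecMulVec 1 1
  have hN : N.PosDef := posDef_one_add_vecMulVec_one
  have hpos (i j) : 0 < N i j := by
    rcases eq_or_ne i j with rfl | hij
    · simp [N]
    · simp [N, hij]
  have hcert : IsDualCertificate ⊤ N⁻¹ (of fun _ _ => 1) N :=
    isDualCertificate_inv hN.isUnit (fun _ _ => abs_one.le)
      fun i j => (one_mul _).trans (abs_of_pos (hpos i j)).symm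
  have hsymm : N⁻¹.IsSymm := hN.inv.isHermitian
  have hrank : N⁻¹.rank = r := by
    rw [rank_of_isUnit _ hN.inv.isUnit, Fintype.card_fin]
  refine ⟨pad e N⁻¹, by rw [IsSymm, transpose_pad, hsymm.eq], by rw [rank_pad, hrank], ?_⟩
  have hopt := (hcert.pad e (𝒱' := ⊤) Submodule.mem_top
    fun _ _ => Submodule.mem_top).hasUniqueExtremeOptimum
  have hcard : nnzEntries (pad e N) = r ^ 2 := by
    simp [nnzEntries_pad, (hpos _ _).ne', Set.ncard_univ, sq]
  rwa [ginvRegionIn_top, hcard] at hopt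

end Nonsymmetric

section Bordered

variable {ι τ : Type*} [Fintype ι] [DecidableEq ι] [Fintype τ] [DecidableEq τ]
  {A H W D : Matrix ι ι ℝ} {X : Matrix ι τ ℝ} {B : Matrix τ ι ℝ}

/-- `(A, B)` is the first block column of the inverse of the bordered matrix `[[H, X], [Xᵀ, 0]]`,
for `A` symmetric: then `A` has the kernel spanned by the columns of `X` and `H` is a generalized
inverse of `A`. -/
structure IsBorderedInverse (H : Matrix ι ι ℝ) (X : Matrix ι τ ℝ) (A : Matrix ι ι ℝ)
    (B : Matrix τ ι ℝ) : Prop where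
  isSymm : A.IsSymm
  mul_border : A * X = 0
  mul_border_eq_one : B * X = 1
  add_eq_one : H * A + X * B = 1

theorem exists_isBorderedInverse (hH : H.IsSymm)
    (hinj : ∀ v l, H *ᵥ v + X *ᵥ l = 0 → Xᵀ *ᵥ v = 0 → v = 0 ∧ l = 0) :
    ∃ A B, IsBorderedInverse H X A B := by
  let K : Matrix (ι ⊕ τ) (ι ⊕ τ) ℝ := fromBlocks H X Xᵀ 0
  have hK_inj : Function.Injective K.mulVec := by
    refine (injective_iff_map_eq_zero K.mulVecLin).2 fun u hu => ?_
    rw [mulVecLin_apply, fromBlocks_mulVec, ← Sum.elim_zero_zero, Sum.elim_eq_iff,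
      zero_mulVec, add_zero] at hu
    obtain ⟨hv, hl⟩ := hinj _ _ hu.1 hu.2
    rw [← Sum.elim_comp_inl_inr u, hv, hl, Sum.elim_zero_zero]
  have hK : IsUnit K.det := (isUnit_iff_isUnit_det K).1 (mulVec_injective_iff_isUnit.1 hK_inj)
  have hK_symm : K⁻¹.IsSymm := by
    rw [IsSymm, transpose_nonsing_inv, fromBlocks_transpose, hH.eq, transpose_transpose,
      transpose_zero]
  have hleft : K⁻¹ * K = 1 := nonsing_inv_mul K hK
  have hright : K * K⁻¹ = 1 := mul_nonsing_inv K hK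
  rw [← fromBlocks_toBlocks K⁻¹, fromBlocks_multiply, ← fromBlocks_one, fromBlocks_inj]
    at hleft hright
  simp only [Matrix.mul_zero, add_zero] at hleft
  exact ⟨K⁻¹.toBlocks₁₁, K⁻¹.toBlocks₂₁, ext fun i j => hK_symm.apply (.inl i) (.inl j),
    hleft.2.1, hleft.2.2.2, hright.1⟩

namespace IsBorderedInverse

theorem mul_mul_self (h : IsBorderedInverse H X A B) : A * H * A = A := by
  calc A * H * A = A * (H * A + X * B) := by
        rw [Matrix.mul_add, ← Matrix.mul_assoc, ← Matrix.mul_assoc, h.mul_border,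
          Matrix.zero_mul, add_zero]
    _ = A := by rw [h.add_eq_one, Matrix.mul_one]

theorem ker_mulVecLin (h : IsBorderedInverse H X A B) :
    LinearMap.ker A.mulVecLin = LinearMap.range X.mulVecLin := by
  apply le_antisymm
  · intro v hv
    have hAv : A *ᵥ v = 0 := hv
    refine ⟨B *ᵥ v, ?_⟩
    calc X *ᵥ (B *ᵥ v) = (H * A + X * B) *ᵥ v := by
          rw [add_mulVec, ← mulVec_mulVec, ← mulVec_mulVec, hAv, mulVec_zero, zero_add]
      _ = v := by rw [h.add_eq_one, one_mulVec]
  · rintro _ ⟨l, rfl⟩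
    rw [LinearMap.mem_ker, mulVecLin_apply, mulVecLin_apply, mulVec_mulVec, h.mul_border,
      zero_mulVec]

theorem rank_add_card (h : IsBorderedInverse H X A B) :
    A.rank + Fintype.card τ = Fintype.card ι := by
  have hX : Function.Injective X.mulVecLin :=
    Function.LeftInverse.injective (g := B.mulVec) fun l => by
      rw [mulVecLin_apply, mulVec_mulVec, h.mul_border_eq_one, one_mulVec]
  rw [← Module.finrank_fintype_fun_eq_card ℝ (η := τ), ← LinearMap.finrank_range_of_inj hX,
    ← h.ker_mulVecLin, Matrix.rank, LinearMap.finrank_range_add_finrank_ker,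
    Module.finrank_fintype_fun_eq_card]

theorem exists_eq_border_mul_add (h : IsBorderedInverse H X A B) (hH : H.IsSymm)
    (hD : D.IsSymm) (hADA : A * D * A = 0) : ∃ Z : Matrix ι τ ℝ, D = X * Zᵀ + Z * Xᵀ := by
  have hone : A * H + Bᵀ * Xᵀ = 1 := by
    rw [← transpose_one, ← h.add_eq_one, transpose_add, transpose_mul, transpose_mul, hH.eq,
      h.isSymm.eq]
  refine ⟨H * A * D * Bᵀ + (1 / 2 : ℝ) • (X * B * D * Bᵀ), ?_⟩
  calc D = (H * A + X * B) * D * (A * H + Bᵀ * Xᵀ) := by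
        rw [h.add_eq_one, hone, Matrix.one_mul, Matrix.mul_one]
    _ = H * (A * D * A) * H + X * (B * D * A * H) + H * A * D * Bᵀ * Xᵀ
          + X * (B * D * Bᵀ) * Xᵀ := by
        simp only [Matrix.add_mul, Matrix.mul_add, Matrix.mul_assoc]
        abel
    _ = _ := by
        simp only [hADA, Matrix.mul_zero, Matrix.zero_mul, zero_add, transpose_add,
          transpose_smul, transpose_mul, transpose_transpose, hH.eq, hD.eq, h.isSymm.eq,
          Matrix.add_mul, Matrix.mul_add, Matrix.mul_assoc, Matrix.smul_mul, Matrix.mul_smul]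
        module

theorem isDualCertificate (h : IsBorderedInverse H X A B) (hH : H.IsSymm) (hW : W.IsSymm)
    (hWX : W * X = 0) (habs_le : ∀ i j, |W i j| ≤ 1) (hmul : ∀ i j, W i j * H i j = |H i j|)
    (huniq : ∀ Z : Matrix ι τ ℝ, (∀ i j, |W i j| < 1 → (X * Zᵀ + Z * Xᵀ) i j = 0) →
      X * Zᵀ + Z * Xᵀ = 0) :
    IsDualCertificate (symmetricMatrices ι) A W H where
  mem := hH
  mul_mul_self := h.mul_mul_self
  trace_eq_zero D hD hADA := by
    obtain ⟨Z, rfl⟩ := h.exists_eq_border_mul_add hH hD hADA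
    rw [hW.eq, Matrix.mul_add, ← Matrix.mul_assoc, hWX, Matrix.zero_mul, zero_add,
      trace_mul_comm, Matrix.mul_assoc, ← hW.eq, ← transpose_mul, hWX, transpose_zero,
      Matrix.mul_zero, trace_zero]
  abs_le_one := habs_le
  mul_eq_abs := hmul
  eq_zero D hD hADA hzero := by
    obtain ⟨Z, rfl⟩ := h.exists_eq_border_mul_add hH hD hADA
    exact huniq Z hzero

end IsBorderedInverse

end Bordered

theorem exists_isSymm_rank_add_card_hasUniqueExtremeOptimum {ι τ : Type*} [Fintype ι] [Fintype τ]
    {H W : Matrix ι ι ℝ} {X : Matrix ι τ ℝ} {n : ℕ} (hn : Fintype.card ι ≤ n)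
    (hH : H.IsSymm) (hW : W.IsSymm) (hWX : W * X = 0) (habs_le : ∀ i j, |W i j| ≤ 1)
    (hmul : ∀ i j, W i j * H i j = |H i j|)
    (hinj : ∀ v l, H *ᵥ v + X *ᵥ l = 0 → Xᵀ *ᵥ v = 0 → v = 0 ∧ l = 0)
    (huniq : ∀ Z : Matrix ι τ ℝ, (∀ i j, |W i j| < 1 → (X * Zᵀ + Z * Xᵀ) i j = 0) →
      X * Zᵀ + Z * Xᵀ = 0) :
    ∃ A : Matrix (Fin n) (Fin n) ℝ, A.IsSymm ∧ A.rank + Fintype.card τ = Fintype.card ι ∧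
      HasUniqueExtremeOptimum (symGinvRegion A) {ij : ι × ι | H ij.1 ij.2 ≠ 0}.ncard := by
  classical
  obtain ⟨e⟩ : Nonempty (ι ↪ Fin n) :=
    Function.Embedding.nonempty_of_card_le (by rwa [Fintype.card_fin])
  obtain ⟨A, B, hAB⟩ := exists_isBorderedInverse hH hinj
  refine ⟨pad e A, by rw [IsSymm, transpose_pad, hAB.isSymm.eq],
    by rw [rank_pad, hAB.rank_add_card], ?_⟩
  have hcert := (hAB.isDualCertificate hH hW hWX habs_le hmul huniq).pad e
    (𝒱' := symmetricMatrices (Fin n)) ((transpose_pad e H).trans (congrArg (pad e) hH))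
    fun _ hD => IsSymm.submatrix hD e
  rw [← ginvRegionIn_symmetricMatrices, ← nnzEntries_pad e]
  exact hcert.hasUniqueExtremeOptimum

section Seidel

variable {ι : Type*}

/-- A Seidel matrix: symmetric, zero on the diagonal, and `±1` off it. -/
structure IsSeidel (S : Matrix ι ι ℝ) : Prop where
  isSymm : S.IsSymm
  apply_self : ∀ i, S i i = 0
  abs_eq_one : ∀ i j, i ≠ j → |S i j| = 1

theorem IsSeidel.ncard_apply_ne_zero [Fintype ι] {S : Matrix ι ι ℝ} (hS : IsSeidel S) :
    {ij : ι × ι | S ij.1 ij.2 ≠ 0}.ncard = Fintype.card ι * Fintype.card ι - Fintype.card ι := by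
  classical
  rw [← Finset.card_univ, ← Finset.offDiag_card, ← Set.ncard_coe_finset]
  congr 1
  ext ⟨i, j⟩
  rcases eq_or_ne i j with rfl | hij
  · simp [hS.apply_self]
  · simp [hij, ← abs_pos, hS.abs_eq_one i j hij]

variable [DecidableEq ι]

theorem IsSeidel.add_diagonal_apply_self {S : Matrix ι ι ℝ} (hS : IsSeidel S) (d : ι → ℝ)
    (i : ι) : (S + diagonal d) i i = d i := by
  rw [Matrix.add_apply, hS.apply_self, diagonal_apply_eq, zero_add]

theorem add_diagonal_apply_of_ne (S : Matrix ι ι ℝ) (d : ι → ℝ) {i j : ι} (hij : i ≠ j) :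
    (S + diagonal d) i j = S i j := by
  rw [Matrix.add_apply, diagonal_apply_ne _ hij, add_zero]

theorem IsSeidel.exists_isSymm_rank_hasUniqueExtremeOptimum [Fintype ι] {S : Matrix ι ι ℝ}
    (hS : IsSeidel S) {d y : ι → ℝ} (hd : ∀ i, |d i| < 1) (hy : ∀ i, y i ≠ 0)
    (hSy : (S + diagonal d) *ᵥ y = 0)
    (hinj : ∀ (v : ι → ℝ) (l : ℝ), S *ᵥ v + l • y = 0 → y ⬝ᵥ v = 0 → v = 0 ∧ l = 0)
    {n : ℕ} (hn : Fintype.card ι ≤ n) :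
    ∃ A : Matrix (Fin n) (Fin n) ℝ, A.IsSymm ∧ A.rank + 1 = Fintype.card ι ∧
      HasUniqueExtremeOptimum (symGinvRegion A)
        (Fintype.card ι * Fintype.card ι - Fintype.card ι) := by
  have hsymm : (S + diagonal d).IsSymm := hS.isSymm.add (isSymm_diagonal d)
  have hmul : (S + diagonal d) * replicateCol Unit y = 0 := by
    rw [← replicateCol_mulVec, hSy, replicateCol_zero]
  have habs_le (i j) : |(S + diagonal d) i j| ≤ 1 := by
    rcases eq_or_ne i j with rfl | hij
    · exact hS.add_diagonal_apply_self d i ▸ (hd i).le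
    · exact add_diagonal_apply_of_ne S d hij ▸ (hS.abs_eq_one i j hij).le
  have hmul_eq_abs (i j) : (S + diagonal d) i j * S i j = |S i j| := by
    rcases eq_or_ne i j with rfl | hij
    · simp [hS.apply_self]
    · rw [add_diagonal_apply_of_ne S d hij, ← abs_mul_abs_self, hS.abs_eq_one i j hij, one_mul]
  have huniq (Z : Matrix ι Unit ℝ) (hZ : ∀ i j, |(S + diagonal d) i j| < 1 →
      (replicateCol Unit y * Zᵀ + Z * (replicateCol Unit y)ᵀ) i j = 0) : Z = 0 := by
    ext i ⟨⟩
    have hentry : y i * Z i () + Z i () * y i = 0 := by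
      simpa [mul_apply] using hZ i i (hS.add_diagonal_apply_self d i ▸ hd i)
    exact (mul_eq_zero.1 (by linear_combination hentry / 2)).resolve_left (hy i)
  have hinj' (v : ι → ℝ) (l : Unit → ℝ) (hv : S *ᵥ v + replicateCol Unit y *ᵥ l = 0)
      (hyv : (replicateCol Unit y)ᵀ *ᵥ v = 0) : v = 0 ∧ l = 0 := by
    have hl : S *ᵥ v + l () • y = 0 := by
      rw [← hv]
      ext i
      simp [mulVec, dotProduct, mul_comm]
    obtain ⟨hv_zero, hl_zero⟩ := hinj v (l ()) hl (congrFun hyv ())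
    exact ⟨hv_zero, funext fun _ => hl_zero⟩
  obtain ⟨A, hA, hrank, hopt⟩ := exists_isSymm_rank_add_card_hasUniqueExtremeOptimum hn
    hS.isSymm hsymm hmul habs_le hmul_eq_abs hinj' fun Z hZ => by simp [huniq Z hZ]
  exact ⟨A, hA, hrank, hS.ncard_apply_ne_zero ▸ hopt⟩

end Seidel

section SeidelFamily

variable {N : ℕ}

/-- The Seidel matrices behind the sharpness of the symmetric bound for ranks `N + 3 ≥ 4`. -/
def seidelFamily (N : ℕ) : Matrix (Fin N ⊕ Fin 4) (Fin N ⊕ Fin 4) ℝ :=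
  fromBlocks (of fun i j => if i = j then 0 else 1) (of fun _ => ![1, 1, -1, -1])
    (of fun a _ => ![1, 1, -1, -1] a)
    !![0, -1, 1, -1; -1, 0, -1, 1; 1, -1, 0, 1; -1, 1, 1, 0]

/-- The diagonal for which `seidelFamily N + diagonal (seidelFamilyDiag N)` annihilates
`seidelFamilyKernel N`; the sum is the dual matrix certifying that `seidelFamily N` is optimal. -/
noncomputable def seidelFamilyDiag (N : ℕ) : Fin N ⊕ Fin 4 → ℝ :=
  Sum.elim 0 ![0, 0, -(N - 1) / (3 * N - 1), -(N - 1) / (3 * N - 1)]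

/-- The vector spanning the kernel of the symmetric matrix of which `seidelFamily N` is the
minimal generalized inverse. -/
def seidelFamilyKernel (N : ℕ) : Fin N ⊕ Fin 4 → ℝ :=
  Sum.elim 2 ![2 * N, 2 * N, 3 * N - 1, 3 * N - 1]

theorem isSeidel_seidelFamily : IsSeidel (seidelFamily N) where
  isSymm := by
    ext (i | a) (j | b)
    · simp [seidelFamily, eq_comm]
    · rfl
    · rfl
    · fin_cases a <;> fin_cases b <;> rfl
  apply_self := by
    rintro (i | a)
    · simp [seidelFamily]
    · fin_cases a <;> rfl
  abs_eq_one := by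
    rintro (i | a) (j | b) hij
    · simp [seidelFamily, show i ≠ j by rintro rfl; exact hij rfl]
    · fin_cases b <;> simp [seidelFamily]
    · fin_cases a <;> simp [seidelFamily]
    · fin_cases a <;> fin_cases b <;> simp [seidelFamily] at hij ⊢

theorem seidelFamily_mulVec_inl (v : Fin N ⊕ Fin 4 → ℝ) (i : Fin N) :
    (seidelFamily N *ᵥ v) (.inl i) = ∑ j, v (.inl j) - v (.inl i) + v (.inr 0) + v (.inr 1)
      - v (.inr 2) - v (.inr 3) := by
  simp only [mulVec, dotProduct, seidelFamily, Fintype.sum_sum_type, fromBlocks_apply₁₁,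
    fromBlocks_apply₁₂, of_apply, ite_mul, zero_mul, one_mul, Finset.sum_ite,
    Finset.sum_const_zero, Finset.filter_ne, Finset.mem_univ, Finset.sum_erase_eq_sub, zero_add,
    Fin.sum_univ_four, cons_val_zero, cons_val_one, cons_val, neg_mul]
  ring

theorem seidelFamily_mulVec_inr (v : Fin N ⊕ Fin 4 → ℝ) (a : Fin 4) :
    (seidelFamily N *ᵥ v) (.inr a) =
      ![∑ j, v (.inl j) - v (.inr 1) + v (.inr 2) - v (.inr 3),
        ∑ j, v (.inl j) - v (.inr 0) - v (.inr 2) + v (.inr 3),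
        -∑ j, v (.inl j) + v (.inr 0) - v (.inr 1) + v (.inr 3),
        -∑ j, v (.inl j) - v (.inr 0) + v (.inr 1) + v (.inr 2)] a := by
  fin_cases a <;> simp [seidelFamily, mulVec, dotProduct, Fin.sum_univ_four] <;> ring

theorem seidelFamily_add_diagonal_mulVec_kernel (hN : 1 ≤ N) :
    (seidelFamily N + diagonal (seidelFamilyDiag N)) *ᵥ seidelFamilyKernel N = 0 := by
  have hN' : (1 : ℝ) ≤ N := Nat.one_le_cast.2 hN
  have hne : (3 * N - 1 : ℝ) ≠ 0 := by linarith
  ext (i | a)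
  · rw [add_mulVec, Pi.add_apply, seidelFamily_mulVec_inl, mulVec_diagonal]
    simp only [seidelFamilyKernel, Sum.elim_inl, Pi.ofNat_apply, Finset.sum_const,
      Finset.card_univ, Fintype.card_fin, nsmul_eq_mul, Sum.elim_inr, cons_val_zero, cons_val_one,
      cons_val, seidelFamilyDiag, zero_mul, add_zero]
    ring
  · rw [add_mulVec, Pi.add_apply, seidelFamily_mulVec_inr, mulVec_diagonal]
    fin_cases a <;> simp [seidelFamilyKernel, seidelFamilyDiag, hne] <;> ring

theorem abs_seidelFamilyDiag_lt_one (hN : 1 ≤ N) (i : Fin N ⊕ Fin 4) :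
    |seidelFamilyDiag N i| < 1 := by
  have hN' : (1 : ℝ) ≤ N := Nat.one_le_cast.2 hN
  have hlt : |-(N - 1) / (3 * N - 1 : ℝ)| < 1 := by
    rw [abs_div, abs_neg, abs_of_nonneg (by linarith), abs_of_pos (by linarith),
      div_lt_one (by linarith)]
    linarith
  rcases i with i | a
  · simp [seidelFamilyDiag]
  · fin_cases a
    exacts [abs_zero.trans_lt one_pos, abs_zero.trans_lt one_pos, hlt, hlt]

theorem seidelFamilyKernel_ne_zero (hN : 1 ≤ N) (i : Fin N ⊕ Fin 4) :
    seidelFamilyKernel N i ≠ 0 := by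
  have hN' : (1 : ℝ) ≤ N := Nat.one_le_cast.2 hN
  have h₁ : (2 * N : ℝ) ≠ 0 := by linarith
  have h₂ : (3 * N - 1 : ℝ) ≠ 0 := by linarith
  rcases i with _ | a
  · simp [seidelFamilyKernel]
  · fin_cases a
    exacts [h₁, h₁, h₂, h₂]

theorem eq_zero_of_seidelFamily_equations {N u a b c d l : ℝ} (hN : 1 ≤ N)
    (hu : N * u - u + a + b - c - d + l * 2 = 0) (ha : N * u - b + c - d + l * (2 * N) = 0)
    (hb : N * u - a - c + d + l * (2 * N) = 0)
    (hc : -(N * u) + a - b + d + l * (3 * N - 1) = 0)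
    (hd : -(N * u) - a + b + c + l * (3 * N - 1) = 0)
    (hy : 2 * N * u + 2 * N * (a + b) + (3 * N - 1) * (c + d) = 0) :
    u = 0 ∧ a = 0 ∧ b = 0 ∧ c = 0 ∧ d = 0 ∧ l = 0 := by
  have hab : a + b = 2 * N * u + 4 * N * l := by linear_combination -ha - hb
  have hcd : c + d = 2 * N * u - 2 * (3 * N - 1) * l := by linear_combination hc + hd
  have hab' : a = b := by linear_combination (ha - hb) / 5 + 2 / 5 * (hc - hd)
  have hcd' : c = d := by linear_combination 2 / 5 * (ha - hb) - (hc - hd) / 5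
  have hul : (N - 1) * u + 10 * N * l = 0 := by linear_combination hu - hab + hcd
  have hul' : 5 * N ^ 2 * u = (5 * N - 1) * (N - 1) * l := by
    linear_combination hy / 2 - N * hab - (3 * N - 1) / 2 * hcd
  have hl : l = 0 := by
    have hpos : 0 < 50 * N ^ 3 + (5 * N - 1) * (N - 1) ^ 2 := by
      have : 0 ≤ (5 * N - 1) * (N - 1) ^ 2 := mul_nonneg (by linarith) (sq_nonneg _)
      positivity
    refine (mul_eq_zero.1 ?_).resolve_left hpos.ne'
    linear_combination 5 * N ^ 2 * hul - (N - 1) * hul'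
  subst hl
  have hu_zero : u = 0 := by
    have hN2 : 5 * N ^ 2 ≠ 0 := by positivity
    exact (mul_eq_zero.1 (hul'.trans (mul_zero _))).resolve_left hN2
  subst hu_zero
  refine ⟨rfl, ?_, ?_, ?_, ?_, rfl⟩ <;> linarith

theorem eq_zero_of_seidelFamily_bordered (hN : 1 ≤ N) {v : Fin N ⊕ Fin 4 → ℝ} {l : ℝ}
    (hv : seidelFamily N *ᵥ v + l • seidelFamilyKernel N = 0)
    (hyv : seidelFamilyKernel N ⬝ᵥ v = 0) : v = 0 ∧ l = 0 := by
  have hinl (i) : ∑ j, v (.inl j) - v (.inl i) + v (.inr 0) + v (.inr 1) - v (.inr 2)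
      - v (.inr 3) + l * 2 = 0 := by
    simpa [seidelFamily_mulVec_inl, seidelFamilyKernel] using congrFun hv (.inl i)
  obtain ⟨u, hu⟩ : ∃ u, ∀ i, v (.inl i) = u :=
    ⟨v (.inl ⟨0, hN⟩), fun i => by linear_combination hinl ⟨0, hN⟩ - hinl i⟩
  have hsum : ∑ j, v (.inl j) = N * u := by simp [hu]
  have hinr (a) := congrFun hv (.inr a)
  simp only [Pi.add_apply, seidelFamily_mulVec_inr, hsum] at hinr
  have hu_row := hinl ⟨0, hN⟩
  rw [hsum, hu] at hu_row
  have hy : 2 * N * u + 2 * N * (v (.inr 0) + v (.inr 1))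
      + (3 * N - 1) * (v (.inr 2) + v (.inr 3)) = 0 := by
    rw [← hyv]
    simp only [dotProduct, seidelFamilyKernel, Fintype.sum_sum_type, Sum.elim_inl,
      Pi.ofNat_apply, hu, Finset.sum_const, Finset.card_univ, Fintype.card_fin, nsmul_eq_mul,
      Sum.elim_inr, Fin.sum_univ_four, cons_val_zero, cons_val_one, cons_val]
    ring
  obtain ⟨rfl, hv₀, hv₁, hv₂, hv₃, rfl⟩ := eq_zero_of_seidelFamily_equations
    (Nat.one_le_cast.2 hN) hu_row (hinr 0) (hinr 1) (hinr 2) (hinr 3) hy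
  refine ⟨?_, rfl⟩
  ext (i | a)
  · exact hu i
  · fin_cases a <;> assumption

theorem exists_isSymm_rank_hasUniqueExtremeOptimum_symGinvRegion_of_four_le {n r : ℕ}
    (hr : 4 ≤ r) (hrn : r + 1 ≤ n) :
    ∃ A : Matrix (Fin n) (Fin n) ℝ, A.IsSymm ∧ A.rank = r ∧
      HasUniqueExtremeOptimum (symGinvRegion A) (r ^ 2 + r) := by
  obtain ⟨N, rfl⟩ := Nat.exists_eq_add_of_le' hr
  have hN : 1 ≤ N + 1 := Nat.le_add_left 1 N
  have hcard : Fintype.card (Fin (N + 1) ⊕ Fin 4) = N + 4 + 1 := by simp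
  obtain ⟨A, hA, hrank, hopt⟩ := isSeidel_seidelFamily.exists_isSymm_rank_hasUniqueExtremeOptimum
    (abs_seidelFamilyDiag_lt_one hN) (seidelFamilyKernel_ne_zero hN)
    (seidelFamily_add_diagonal_mulVec_kernel hN)
    (fun _ _ => eq_zero_of_seidelFamily_bordered hN) (hcard.trans_le hrn)
  refine ⟨A, hA, by omega, ?_⟩
  convert hopt using 1
  rw [hcard]
  exact Nat.eq_sub_of_add_eq (by ring)

end SeidelFamily

section RankThree

/-- The adjacency matrix of the complement of the path on five vertices; it is the unique
minimiser in the example of rank three. -/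
def pathComplement : Matrix (Fin 5) (Fin 5) ℝ :=
  !![0, 0, 1, 1, 1; 0, 0, 0, 1, 1; 1, 0, 0, 0, 1; 1, 1, 0, 0, 0; 1, 1, 1, 0, 0]

/-- The dual matrix certifying that `pathComplement` is optimal. -/
noncomputable def pathComplementDual : Matrix (Fin 5) (Fin 5) ℝ :=
  !![1 / 3, 0, 1, 1, 1; 0, -1 / 2, 1 / 2, 1, 1; 1, 1 / 2, -1 / 2, 0, 1; 1, 1, 0, -1 / 3, 1 / 3;
    1, 1, 1, 1 / 3, 2 / 3]

/-- The columns span the kernel of `pathComplementDual`, which is also the kernel of the rank-three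
matrix of which `pathComplement` is the minimal symmetric generalized inverse. -/
def pathComplementKernel : Matrix (Fin 5) (Fin 2) ℝ :=
  !![-3, -6; 4, 5; -2, -1; 3, 0; 0, 3]

theorem isSymm_pathComplement : pathComplement.IsSymm :=
  ext fun i j => by fin_cases i <;> fin_cases j <;> rfl

theorem isSymm_pathComplementDual : pathComplementDual.IsSymm :=
  ext fun i j => by fin_cases i <;> fin_cases j <;> rfl

theorem pathComplementDual_mul_kernel : pathComplementDual * pathComplementKernel = 0 := by
  ext i j
  fin_cases i <;> fin_cases j <;>
    simp [pathComplementDual, pathComplementKernel, mul_apply, Fin.sum_univ_five] <;> norm_num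

theorem abs_pathComplementDual_le_one (i j : Fin 5) : |pathComplementDual i j| ≤ 1 := by
  fin_cases i <;> fin_cases j <;> simp [pathComplementDual, abs_le] <;> norm_num

theorem abs_pathComplementDual_lt_one {i j : Fin 5} (hij : pathComplement i j = 0) :
    |pathComplementDual i j| < 1 := by
  fin_cases i <;> fin_cases j <;>
    simp [pathComplement, pathComplementDual, abs_lt] at hij ⊢ <;> norm_num

theorem pathComplementDual_mul_eq_abs (i j : Fin 5) :
    pathComplementDual i j * pathComplement i j = |pathComplement i j| := by
  fin_cases i <;> fin_cases j <;> simp [pathComplementDual, pathComplement]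

theorem ncard_pathComplement_ne_zero :
    {ij : Fin 5 × Fin 5 | pathComplement ij.1 ij.2 ≠ 0}.ncard = 12 := by
  have hset : {ij : Fin 5 × Fin 5 | pathComplement ij.1 ij.2 ≠ 0} =
      {ij | (ij.1 : ℕ) + 1 < (ij.2 : ℕ) ∨ (ij.2 : ℕ) + 1 < (ij.1 : ℕ)} := by
    ext ⟨i, j⟩
    fin_cases i <;> fin_cases j <;> simp [pathComplement]
  rw [hset, ← Finset.coe_filter_univ, Set.ncard_coe_finset]
  decide

theorem eq_zero_of_pathComplement_bordered {v : Fin 5 → ℝ} {l : Fin 2 → ℝ}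
    (hv : pathComplement *ᵥ v + pathComplementKernel *ᵥ l = 0)
    (hKv : pathComplementKernelᵀ *ᵥ v = 0) : v = 0 ∧ l = 0 := by
  have hrow (i) := congrFun hv i
  have hborder (k) := congrFun hKv k
  simp only [pathComplement, cons_mulVec, dotProduct, Fin.sum_univ_five, cons_val_zero, zero_mul,
    cons_val_one, add_zero, cons_val, one_mul, zero_add, empty_mulVec, pathComplementKernel,
    Fin.sum_univ_two, neg_mul, cons_val_fin_one, Pi.add_apply, Pi.zero_apply, Fin.forall_fin_succ,
    cons_val_succ, mulVec, transpose_apply, of_apply, cons_val'] at hrow hborder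
  obtain ⟨h₀, h₁, h₂, h₃, h₄, -⟩ := hrow
  obtain ⟨h₅, h₆, -⟩ := hborder
  constructor
  · ext i
    fin_cases i <;> (dsimp; linarith)
  · ext k
    fin_cases k <;> (dsimp; linarith)

theorem exists_eq_pathComplementKernel_mul {Z : Matrix (Fin 5) (Fin 2) ℝ}
    (hZ : ∀ i j, pathComplement i j = 0 →
      (pathComplementKernel * Zᵀ + Z * pathComplementKernelᵀ) i j = 0) :
    ∃ c : ℝ, Z = pathComplementKernel * !![0, c; -c, 0] := by
  have hentry (i j) (hij : pathComplement i j = 0) :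
      pathComplementKernel i 0 * Z j 0 + pathComplementKernel i 1 * Z j 1
        + (Z i 0 * pathComplementKernel j 0 + Z i 1 * pathComplementKernel j 1) = 0 := by
    simpa [mul_apply] using hZ i j hij
  have h₀₀ := hentry 0 0 rfl
  have h₀₁ := hentry 0 1 rfl
  have h₁₁ := hentry 1 1 rfl
  have h₁₂ := hentry 1 2 rfl
  have h₂₂ := hentry 2 2 rfl
  have h₂₃ := hentry 2 3 rfl
  have h₃₃ := hentry 3 3 rfl
  have h₃₄ := hentry 3 4 rfl
  have h₄₄ := hentry 4 4 rfl
  simp only [pathComplementKernel, of_apply, cons_val', cons_val_zero, cons_val_fin_one, neg_mul,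
    cons_val_one, mul_neg, cons_val, mul_one, one_mul, mul_zero, add_zero, zero_mul, zero_add]
    at h₀₀ h₀₁ h₁₁ h₁₂ h₂₂ h₂₃ h₃₃ h₃₄ h₄₄
  refine ⟨Z 3 1 / 3, ext fun i k => ?_⟩
  fin_cases i <;> fin_cases k <;> simp [pathComplementKernel] <;> linarith

theorem exists_isSymm_rank_hasUniqueExtremeOptimum_symGinvRegion_three {n : ℕ} (hn : 5 ≤ n) :
    ∃ A : Matrix (Fin n) (Fin n) ℝ, A.IsSymm ∧ A.rank = 3 ∧
      HasUniqueExtremeOptimum (symGinvRegion A) 12 := by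
  obtain ⟨A, hA, hrank, hopt⟩ := exists_isSymm_rank_add_card_hasUniqueExtremeOptimum
    hn isSymm_pathComplement isSymm_pathComplementDual pathComplementDual_mul_kernel
    abs_pathComplementDual_le_one pathComplementDual_mul_eq_abs
    (fun _ _ => eq_zero_of_pathComplement_bordered) fun Z hZ => by
      obtain ⟨c, rfl⟩ := exists_eq_pathComplementKernel_mul
        fun i j hij => hZ i j (abs_pathComplementDual_lt_one hij)
      have hskew : (!![0, c; -c, 0]ᵀ + !![0, c; -c, 0] : Matrix (Fin 2) (Fin 2) ℝ) = 0 := by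
        ext i j
        fin_cases i <;> fin_cases j <;> simp
      rw [transpose_mul, ← Matrix.mul_assoc, ← Matrix.add_mul, ← Matrix.mul_add, hskew,
        Matrix.mul_zero, Matrix.zero_mul]
  exact ⟨A, hA, Nat.add_right_cancel hrank, ncard_pathComplement_ne_zero ▸ hopt⟩

end RankThree

theorem mainTheorem6_general :
    (∀ (n r : ℕ) (A : Matrix (Fin n) (Fin n) ℝ), A.rank = r →
      ∀ p ∈ (ginvRegion A).extremePoints ℝ, nnzEntries (p.1 - p.2) ≤ r ^ 2) ∧
    (∀ n r : ℕ, r ≤ n → ∃ A : Matrix (Fin n) (Fin n) ℝ, A.IsSymm ∧ A.rank = r ∧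
      HasUniqueExtremeOptimum (ginvRegion A) (r ^ 2)) ∧
    (∀ (n r : ℕ) (A : Matrix (Fin n) (Fin n) ℝ), A.IsSymm → A.rank = r →
      ∀ p ∈ (symGinvRegion A).extremePoints ℝ, nnzEntries (p.1 - p.2) ≤ r ^ 2 + r) ∧
    (∀ n r : ℕ, 3 ≤ r → r + 1 ≤ n → 5 ≤ n →
      ∃ A : Matrix (Fin n) (Fin n) ℝ, A.IsSymm ∧ A.rank = r ∧
        HasUniqueExtremeOptimum (symGinvRegion A) (r ^ 2 + r)) := by
  refine ⟨fun _ _ _ hr _ => nnzEntries_le_of_mem_extremePoints_ginvRegion hr,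
    fun _ _ => exists_isSymm_rank_hasUniqueExtremeOptimum_ginvRegion,
    fun _ _ _ hA hr _ => nnzEntries_le_of_mem_extremePoints_symGinvRegion hA hr,
    fun n r hr hrn hn => ?_⟩
  rcases hr.eq_or_lt with rfl | hr
  · exact exists_isSymm_rank_hasUniqueExtremeOptimum_symGinvRegion_three hn
  · exact exists_isSymm_rank_hasUniqueExtremeOptimum_symGinvRegion_of_four_le hr hrn

theorem mainTheorem6 :
    -- extreme solutions of the LP for `min {‖H‖₁ : A H A = A}` have at most `r²` nonzeros
    (∀ (n r : ℕ) (A : Matrix (Fin n) (Fin n) ℝ), A.IsSymm → A.rank = r →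
      ∀ p ∈ (ginvRegion A).extremePoints ℝ, nnzEntries (p.1 - p.2) ≤ r ^ 2) ∧
    -- this bound is sharp for all `n ≥ r ≥ 1`
    (∀ n r : ℕ, 1 ≤ r → r ≤ n →
      ∃ A : Matrix (Fin n) (Fin n) ℝ, A.IsSymm ∧ A.rank = r ∧
        ∃ p ∈ (ginvRegion A).extremePoints ℝ,
          IsLPOptimal (ginvRegion A) p ∧
          (∀ q, IsLPOptimal (ginvRegion A) q → q = p) ∧
          nnzEntries (p.1 - p.2) = r ^ 2) ∧
    -- extreme solutions of the LP for `min {‖H‖₁ : A H A = A, Hᵀ = H}` have at most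
    -- `r² + r` nonzeros
    (∀ (n r : ℕ) (A : Matrix (Fin n) (Fin n) ℝ), A.IsSymm → A.rank = r →
      ∀ p ∈ (symGinvRegion A).extremePoints ℝ, nnzEntries (p.1 - p.2) ≤ r ^ 2 + r) ∧
    -- this bound is sharp for `n - 2 ≥ r ≥ 3`
    (∀ n r : ℕ, 3 ≤ r → r + 2 ≤ n →
      ∃ A : Matrix (Fin n) (Fin n) ℝ, A.IsSymm ∧ A.rank = r ∧
        ∃ p ∈ (symGinvRegion A).extremePoints ℝ,
          IsLPOptimal (symGinvRegion A) p ∧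
          (∀ q, IsLPOptimal (symGinvRegion A) q → q = p) ∧
          nnzEntries (p.1 - p.2) = r ^ 2 + r) := by
  obtain ⟨hbound, hsharp, hsymBound, hsymSharp⟩ := mainTheorem6_general
  exact ⟨fun n r A _ => hbound n r A, fun n r _ => hsharp n r, hsymBound,
    fun n r hr hrn => hsymSharp n r hr (by omega) (by omega)⟩
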